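/- Let $\Gamma$ be an infinite group generated by a finite set $A$, and suppose that $\Gamma$ is algorithmically finite with respect to $A$: there is no computable enumeration of an infinite set of words in the free group $\mathbb F_A$ that represent pairwise distinct elements of $\Gamma$. Let $X$ be any finite generating set of $\Gamma$ (repetitions and the identity are allowed among the listed generators), let $\pi:\mathbb F_X\to\Gamma$ be the canonical epimorphism and let $B_n$ be the ball of radius $n$ in $\mathbb F_X$, that is, the set of freely reduced words of length at most $n$. Then the following hold. 1. $\Gamma$ has unsolvable UB-generic Word Problem with respect to $X$. That is, the Word Problem of $\Gamma$ is unsolvable on every upper Banach generic set $S\subseteq\mathbb F_X$, i.e. on every $S$ with $$\limsup_{n\to\infty}\ \max_{\omega\in\mathbb F_X}\frac{|S\cap \omega B_n|}{|B_n|}=1.$$ 2. $\Gamma$ has unsolvable generic Word Problem with respect to $X$. That is, the Word Problem of $\Gamma$ is unsolvable on every generic set $S\subseteq\mathbb F_X$, i.e. on every $S$ with $$\lim_{n\to\infty}\frac{|(\mathbb F_X\setminus S)\cap B_n|}{|B_n|}=0.$$ Here the Word Problem of $\Gamma$ is solvable on a set $S\subseteq\mathbb F_X$ if there is a partial algorithm,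 taking words of $\mathbb F_X$ as input, that halts at least on every $\omega\in S$ and, whenever it halts on a word $\omega\in\mathbb F_X$, correctly decides whether $\pi(\omega)=1$. -/

import Mathlib

open Filter Topology

/-!
Words are the elements of the free group on `d` letters; a finite generating set of a group `G`,
listed as `x : Fin d → G`, gives the canonical map `FreeGroup.lift x` from words to `G`.
Algorithms read and write freely reduced words `w.toWord : List (Fin d × Bool)`.
-/

namespace GenericWP

/-- The ball of radius `n` in the free group on `d` letters, for the length of reduced words. -/
def ball (d n : ℕ) : Set (FreeGroup (Fin d)) := {w | w.norm ≤ n}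

theorem ball_finite (d n : ℕ) : (ball d n).Finite := by
  refine Set.Finite.of_finite_image ((List.finite_length_le (Fin d × Bool) n).subset ?_)
    FreeGroup.toWord_injective.injOn
  rintro _ ⟨w, hw, rfl⟩
  exact hw

/-- The proportion of the translated ball `ω Bₙ` that lies in `S`. -/
noncomputable def ballDensity {d : ℕ} (S : Set (FreeGroup (Fin d))) (ω : FreeGroup (Fin d))
    (n : ℕ) : ℝ :=
  ((S ∩ (fun b => ω * b) '' ball d n).ncard : ℝ) / ((ball d n).ncard : ℝ)

/-- The upper Banach density: the limit superior over `n` of the maximum over `ω` of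
`|S ∩ ω Bₙ| / |Bₙ|`. -/
noncomputable def upperBanachDensity {d : ℕ} (S : Set (FreeGroup (Fin d))) : ℝ :=
  limsup (fun n : ℕ => ⨆ ω : FreeGroup (Fin d), ballDensity S ω n) atTop

/-- Upper Banach generic sets of words. -/
def IsUBGeneric {d : ℕ} (S : Set (FreeGroup (Fin d))) : Prop :=
  upperBanachDensity S = 1

/-- Negligible sets of words: `|S ∩ Bₙ| / |Bₙ|` tends to `0`. -/
def IsNegligible {d : ℕ} (S : Set (FreeGroup (Fin d))) : Prop :=
  Tendsto (fun n : ℕ => ((S ∩ ball d n).ncard : ℝ) / ((ball d n).ncard : ℝ)) atTop (𝓝 0)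

/-- Generic sets of words: those with negligible complement. -/
def IsGeneric {d : ℕ} (S : Set (FreeGroup (Fin d))) : Prop :=
  IsNegligible Sᶜ

variable {G : Type*} [Group G] {d : ℕ}

/-- The family `x` generates `G`. -/
def Generates (x : Fin d → G) : Prop :=
  Subgroup.closure (Set.range x) = ⊤

/-- The word problem is solvable on `S`: some partial algorithm halts at least on the words of
`S`, and whenever it halts on a word, it answers correctly whether the word is trivial in `G`. -/
def SolvableWPOn (x : Fin d → G) (S : Set (FreeGroup (Fin d))) : Prop :=
  ∃ f : List (Fin d × Bool) →. Bool, Partrec f ∧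
    (∀ w ∈ S, (f w.toWord).Dom) ∧
    ∀ w : FreeGroup (Fin d), ∀ b ∈ f w.toWord, (b = true ↔ FreeGroup.lift x w = 1)

/-- The UB-generic word problem is solvable with respect to `x`. -/
def SolvableUBGenericWP (x : Fin d → G) : Prop :=
  ∃ S : Set (FreeGroup (Fin d)), IsUBGeneric S ∧ SolvableWPOn x S

/-- The generic word problem is solvable with respect to `x`. -/
def SolvableGenericWP (x : Fin d → G) : Prop :=
  ∃ S : Set (FreeGroup (Fin d)), IsGeneric S ∧ SolvableWPOn x S

/-- Algorithmic finiteness: there is no computable enumeration `f` of an infinite set of words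
that represent pairwise distinct elements of `G`. -/
def AlgorithmicallyFinite (x : Fin d → G) : Prop :=
  ¬ ∃ f : ℕ → FreeGroup (Fin d), Computable (fun n => (f n).toWord) ∧
    (Set.range f).Infinite ∧ Set.InjOn (FreeGroup.lift x) (Set.range f)

end GenericWP

namespace GenericWP

/-! Both notions of genericity enter only through thickness. If `S` is not thick, then for some `r`
every translate of `B_r` misses a point of `S`, and a counting argument keeps every `ballDensity S ω
n` with `n ≥ r` below a constant less than 1 (`exists_forall_ballDensity_le`). On a thick set, a
partial solution of the word problem enumerates new elements: given finitely many words `u`, some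
`v` has every `v * u⁻¹` in `S` and nontrivial in `G` (`IsThick.exists_mul_inv_mem_and_lift_ne`), and
an unbounded search finds a `v` for which the algorithm certifies nontriviality. Iterating
contradicts algorithmic finiteness once words are rewritten in the generators `a`. -/

/-- A set of words is thick if it contains left translates of arbitrarily large balls. -/
def IsThick {d : ℕ} (S : Set (FreeGroup (Fin d))) : Prop :=
  ∀ r : ℕ, ∃ ω : FreeGroup (Fin d), ∀ b ∈ ball d r, ω * b ∈ S

/-! ### Generic sets are thick -/

section Density

variable {d : ℕ} {S : Set (FreeGroup (Fin d))}

theorem one_mem_ball (d n : ℕ) : (1 : FreeGroup (Fin d)) ∈ ball d n := by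
  simp [ball]

theorem ncard_ball_pos (d n : ℕ) : 0 < (ball d n).ncard :=
  (Set.ncard_pos (ball_finite d n)).2 ⟨1, one_mem_ball d n⟩

theorem exists_mul_of_mem_ball {r n : ℕ} (h : r ≤ n) {w : FreeGroup (Fin d)} (hw : w ∈ ball d n) :
    ∃ u ∈ ball d (n - r), ∃ v ∈ ball d r, w = u * v := by
  have hl : w.toWord.length ≤ n := hw
  refine ⟨.mk (w.toWord.take (n - r)), FreeGroup.norm_mk_le.trans ?_,
    .mk (w.toWord.drop (n - r)), FreeGroup.norm_mk_le.trans ?_, ?_⟩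
  · simp
  · rw [List.length_drop]
    omega
  · rw [FreeGroup.mul_mk, List.take_append_drop, FreeGroup.mk_toWord]

/-- Split `w = u * v` with `v` in `B_r`, and choose `b` in `B_r` with `ω * u * b` outside `S`. The
triple `(ω * u * b, b, v)` determines `w`. -/
theorem ncard_ball_le_of_forall_exists_notMem {r n : ℕ}
    (hS : ∀ ω : FreeGroup (Fin d), ∃ b ∈ ball d r, ω * b ∉ S) (hr : r ≤ n)
    (ω : FreeGroup (Fin d)) :
    (ball d n).ncard ≤
      (((fun b => ω * b) '' ball d n) \ S).ncard * ((ball d r).ncard * (ball d r).ncard) := by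
  set T := ((fun b => ω * b) '' ball d n) \ S with hT
  have hfin : (T ×ˢ (ball d r ×ˢ ball d r)).Finite :=
    (((ball_finite d n).image _).sdiff).prod ((ball_finite d r).prod (ball_finite d r))
  rw [← Set.ncard_prod, ← Set.ncard_prod]
  refine (Set.ncard_le_ncard ?_ (hfin.image fun p => ω⁻¹ * p.1 * p.2.1⁻¹ * p.2.2)).trans
    (Set.ncard_image_le hfin)
  intro w hw
  obtain ⟨u, hu, v, hv, rfl⟩ := exists_mul_of_mem_ball hr hw
  obtain ⟨b, hb, hbS⟩ := hS (ω * u)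
  refine ⟨(ω * u * b, b, v), ⟨⟨⟨u * b, ?_, by simp [mul_assoc]⟩, hbS⟩, hb, hv⟩, by group⟩
  have h1 : u.norm ≤ n - r := hu
  have h2 : b.norm ≤ r := hb
  have h3 := FreeGroup.norm_mul_le u b
  show (u * b).norm ≤ n
  omega

theorem ncard_inter_translate_add_ncard_diff (S : Set (FreeGroup (Fin d)))
    (ω : FreeGroup (Fin d)) (n : ℕ) :
    (S ∩ (fun b => ω * b) '' ball d n).ncard + (((fun b => ω * b) '' ball d n) \ S).ncard =
      (ball d n).ncard := by
  rw [Set.inter_comm, Set.ncard_inter_add_ncard_sdiff_eq_ncard _ _ ((ball_finite d n).image _),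
    Set.ncard_image_of_injective _ (mul_right_injective ω)]

theorem ballDensity_le_of_forall_exists_notMem {r n : ℕ}
    (hS : ∀ ω : FreeGroup (Fin d), ∃ b ∈ ball d r, ω * b ∉ S) (hr : r ≤ n)
    (ω : FreeGroup (Fin d)) :
    ballDensity S ω n ≤ 1 - 1 / ((ball d r).ncard * (ball d r).ncard : ℝ) := by
  have h1 : ((ball d n).ncard : ℝ) ≤ (((fun b => ω * b) '' ball d n) \ S).ncard *
      ((ball d r).ncard * (ball d r).ncard) := by
    exact_mod_cast ncard_ball_le_of_forall_exists_notMem hS hr ω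
  have h2 : ((S ∩ (fun b => ω * b) '' ball d n).ncard : ℝ) +
      (((fun b => ω * b) '' ball d n) \ S).ncard = (ball d n).ncard := by
    exact_mod_cast ncard_inter_translate_add_ncard_diff S ω n
  have hn : (0 : ℝ) < (ball d n).ncard := by exact_mod_cast ncard_ball_pos d n
  have hr' : (0 : ℝ) < (ball d r).ncard := by exact_mod_cast ncard_ball_pos d r
  have h3 := (div_le_iff₀ (mul_pos hr' hr')).2 h1
  rw [ballDensity, div_le_iff₀ hn, sub_mul, one_mul, one_div_mul_eq_div]
  linarith

theorem exists_forall_ballDensity_le (hS : ¬ IsThick S) :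
    ∃ c < (1 : ℝ), ∃ r : ℕ, ∀ n ≥ r, ∀ ω, ballDensity S ω n ≤ c := by
  unfold IsThick at hS
  push Not at hS
  obtain ⟨r, hr⟩ := hS
  have hr' : (0 : ℝ) < (ball d r).ncard := by exact_mod_cast ncard_ball_pos d r
  exact ⟨_, sub_lt_self _ (one_div_pos.2 (mul_pos hr' hr')), r, fun n hn ω =>
    ballDensity_le_of_forall_exists_notMem hr hn ω⟩

theorem ballDensity_nonneg (S : Set (FreeGroup (Fin d))) (ω : FreeGroup (Fin d)) (n : ℕ) :
    0 ≤ ballDensity S ω n := by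
  unfold ballDensity
  positivity

theorem IsUBGeneric.isThick (hS : IsUBGeneric S) : IsThick S := by
  by_contra h
  obtain ⟨c, hc, r, hr⟩ := exists_forall_ballDensity_le h
  have hle : upperBanachDensity S ≤ c := by
    refine limsup_le_of_le ?_ ?_
    -- The real-valued `limsup` is meaningful here because the densities are bounded below.
    · exact IsBoundedUnder.isCoboundedUnder_le
        (isBoundedUnder_of ⟨0, fun n => Real.iSup_nonneg fun ω => ballDensity_nonneg S ω n⟩)
    · filter_upwards [eventually_ge_atTop r] with n hn
      exact ciSup_le (hr n hn)
  rw [hS] at hle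
  exact hc.not_ge hle

theorem ballDensity_one_eq (S : Set (FreeGroup (Fin d))) (n : ℕ) :
    ballDensity S 1 n = 1 - ((Sᶜ ∩ ball d n).ncard : ℝ) / ((ball d n).ncard : ℝ) := by
  have h2 : ((S ∩ (fun b => 1 * b) '' ball d n).ncard : ℝ) +
      (((fun b => 1 * b) '' ball d n) \ S).ncard = (ball d n).ncard := by
    exact_mod_cast ncard_inter_translate_add_ncard_diff S 1 n
  have hn : (0 : ℝ) < (ball d n).ncard := by exact_mod_cast ncard_ball_pos d n
  have h3 : Sᶜ ∩ ball d n = ((fun b => 1 * b) '' ball d n) \ S := by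
    simp [Set.sdiff_eq, Set.inter_comm]
  rw [ballDensity, h3, eq_sub_iff_add_eq, ← add_div, h2, div_self hn.ne']

theorem IsGeneric.isThick (hS : IsGeneric S) : IsThick S := by
  by_contra h
  obtain ⟨c, hc, r, hr⟩ := exists_forall_ballDensity_le h
  have ht : Tendsto (fun n => ballDensity S 1 n) atTop (𝓝 (1 - 0)) := by
    simp_rw [ballDensity_one_eq]
    exact tendsto_const_nhds.sub hS
  rw [sub_zero] at ht
  refine hc.not_ge (le_of_tendsto ht ?_)
  filter_upwards [eventually_ge_atTop r] with n hn using hr n hn 1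

end Density

/-! ### Separating words inside a thick set -/

section Group

variable {G : Type*} [Group G] {d : ℕ} {S : Set (FreeGroup (Fin d))}

theorem IsThick.exists_forall_mul_mem (hS : IsThick S) (W : Set (FreeGroup (Fin d)))
    (hW : W.Finite) : ∃ ω, ∀ w ∈ W, ω * w ∈ S := by
  obtain ⟨r, hr⟩ := (hW.image FreeGroup.norm).bddAbove
  obtain ⟨ω, hω⟩ := hS r
  exact ⟨ω, fun w hw => hω w (hr (Set.mem_image_of_mem _ hw))⟩

theorem Generates.lift_surjective {x : Fin d → G} (hx : Generates x) :
    Function.Surjective (FreeGroup.lift x) := by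
  rw [← MonoidHom.range_eq_top, FreeGroup.range_lift_eq_closure]
  exact hx

theorem IsThick.exists_mul_inv_mem_and_lift_ne [Infinite G] {x : Fin d → G} (hx : Generates x)
    (hS : IsThick S) (U : Set (FreeGroup (Fin d))) (hU : U.Finite) :
    ∃ v, ∀ u ∈ U, v * u⁻¹ ∈ S ∧ FreeGroup.lift x (v * u⁻¹) ≠ 1 := by
  classical
  set π := FreeGroup.lift x
  -- Choose `t` with `π t` outside the finite set `π(U)⁻¹ π(U)`. Then `π ω` and `π (ω * t)` cannot
  -- both lie in `π(U)`, so one of `ω`, `ω * t` serves as `v`.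
  obtain ⟨g, hg⟩ := ((hU.image2 (fun u v => (π u)⁻¹ * π v) hU).infinite_compl).nonempty
  obtain ⟨t, rfl⟩ := hx.lift_surjective g
  obtain ⟨ω, hω⟩ := hS.exists_forall_mul_mem
    ((fun u => u⁻¹) '' U ∪ (fun u => t * u⁻¹) '' U) ((hU.image _).union (hU.image _))
  have h1 : ∀ u ∈ U, ω * u⁻¹ ∈ S := fun u hu => hω _ (Or.inl ⟨u, hu, rfl⟩)
  have h2 : ∀ u ∈ U, ω * t * u⁻¹ ∈ S := fun u hu => by
    rw [mul_assoc]
    exact hω _ (Or.inr ⟨u, hu, rfl⟩)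
  by_cases h : ∃ u ∈ U, π ω = π u
  · obtain ⟨u, hu, hωu⟩ := h
    refine ⟨ω * t, fun v hv => ⟨h2 v hv, fun h1 => hg ⟨u, hu, v, hv, ?_⟩⟩⟩
    rw [map_mul, map_inv, mul_inv_eq_one, map_mul, hωu] at h1
    exact (eq_inv_mul_of_mul_eq h1).symm
  · refine ⟨ω, fun u hu => ⟨h1 u hu, fun h1 => h ⟨u, hu, ?_⟩⟩⟩
    rwa [map_mul, map_inv, mul_inv_eq_one] at h1

end Group

/-! ### Computable word operations and searches -/

section Computability

open Primrec in
theorem primrec_reduce {α : Type*} [Primcodable α] [DecidableEq α] :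
    Primrec (FreeGroup.reduce : List (α × Bool) → List (α × Bool)) := by
  have hcond : PrimrecPred fun p : (List (α × Bool) × (α × Bool) × List (α × Bool)) ×
      (α × Bool) × List (α × Bool) =>
      p.1.2.1.1 = p.2.1.1 ∧ p.1.2.1.2 = not p.2.1.2 :=
    (Primrec.eq.comp (fst.comp (fst.comp (snd.comp fst))) (fst.comp (fst.comp snd))).and
      (Primrec.eq.comp (snd.comp (fst.comp (snd.comp fst)))
        (Primrec.not.comp (snd.comp (fst.comp snd))))
  have hstep : Primrec₂ fun (_ : List (α × Bool)) (p : (α × Bool) × List (α × Bool)) =>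
      (List.casesOn p.2 [p.1] fun hd tl =>
        if p.1.1 = hd.1 ∧ p.1.2 = not hd.2 then tl else p.1 :: hd :: tl : List (α × Bool)) :=
    Primrec.list_casesOn (snd.comp snd) (list_cons.comp (fst.comp snd) (const []))
      (Primrec.ite hcond (snd.comp snd)
        (list_cons.comp (fst.comp (snd.comp fst))
          (list_cons.comp (fst.comp snd) (snd.comp snd)))).to₂
  refine (list_foldr Primrec.id (const []) hstep).of_eq fun L => ?_
  induction L with
  | nil => rfl
  | cons a L ih =>
    rw [FreeGroup.reduce.cons, ← ih]
    rfl

open Primrec in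
theorem primrec_invRev {α : Type*} [Primcodable α] :
    Primrec (FreeGroup.invRev : List (α × Bool) → List (α × Bool)) :=
  list_reverse.comp (list_map Primrec.id
    ((Primrec.pair (fst.comp snd) (Primrec.not.comp (snd.comp snd))).to₂))

open Primrec in
/-- Right division of words is primitive recursive. -/
theorem primrec_toWord_mk_mul_mk_inv {α : Type*} [Primcodable α] [DecidableEq α] :
    Primrec₂ fun v u : List (α × Bool) => (FreeGroup.mk v * (FreeGroup.mk u)⁻¹).toWord :=
  (primrec_reduce.comp (list_append.comp fst (primrec_invRev.comp snd))).of_eq fun p => by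
    beta_reduce
    rw [FreeGroup.inv_mk, FreeGroup.mul_mk, FreeGroup.toWord_mk]

/-- A homomorphism between free groups of finite rank acts on words primitive recursively. -/
theorem primrec_toWord_lift_mk {α β : Type*} [Finite α] [Primcodable α] [Primcodable β]
    [DecidableEq β] (φ : α → FreeGroup β) :
    Primrec fun L : List (α × Bool) => (FreeGroup.lift φ (FreeGroup.mk L)).toWord := by
  have hletter : Primrec fun p : α × Bool =>
      (cond p.2 (φ p.1) (φ p.1)⁻¹).toWord := Primrec.dom_finite _
  refine (primrec_reduce.comp (Primrec.list_flatMap Primrec.id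
    (hletter.comp Primrec.snd).to₂)).of_eq fun L => ?_
  rw [← FreeGroup.toWord_mk]
  congr 1
  induction L with
  | nil => rfl
  | cons p L ih =>
    simp only [id_eq] at ih ⊢
    rw [List.flatMap_cons, ← FreeGroup.mul_mk, FreeGroup.mk_toWord, ih]
    rw [FreeGroup.lift_mk, FreeGroup.lift_mk, List.map_cons, List.prod_cons]

/-- A choice, for every list `L`, of some `v` such that a partial algorithm halts with output `b`
on all `(v, u)` with `u ∈ L` can be made computably as soon as such a `v` always exists. -/
theorem exists_computable_forall_mem {α σ : Type*} [Primcodable α] [Primcodable σ]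
    {f : α × α →. σ} (hf : Partrec f) (b : σ)
    (h : ∀ L : List α, ∃ v, ∀ u ∈ L, b ∈ f (v, u)) :
    ∃ g : List α → α, Computable g ∧ ∀ L, ∀ u ∈ L, b ∈ f (g L, u) := by
  obtain ⟨c, hc⟩ := Nat.Partrec.Code.exists_code.1 hf
  have hcf : ∀ p : α × α, Encodable.encode b ∈ c.eval (Encodable.encode p) ↔ b ∈ f p := by
    intro p
    rw [hc]
    simp
  have hP : PrimrecPred fun q : List α × ℕ × α =>
      ∀ u ∈ q.1, c.evaln q.2.1 (Encodable.encode (q.2.2, u)) = some (Encodable.encode b) := by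
    have hR : PrimrecRel fun (u : α) (q : ℕ × α) =>
        c.evaln q.1 (Encodable.encode (q.2, u)) = some (Encodable.encode b) :=
      Primrec.eq.comp
        (Nat.Partrec.Code.primrec_evaln.comp (Primrec.pair
          (Primrec.pair (Primrec.fst.comp Primrec.snd) (Primrec.const c))
          (Primrec.encode.comp (Primrec.pair (Primrec.snd.comp Primrec.snd) Primrec.fst))))
        (Primrec.const _)
    exact hR.forall_mem_list
  classical
  -- Dovetailing: `N` codes a step bound together with a candidate, so each test terminates.
  let F : List α → ℕ → Option α := fun L N => (Encodable.decode (α := ℕ × α) N).bind fun q =>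
    if ∀ u ∈ L, c.evaln q.1 (Encodable.encode (q.2, u)) = some (Encodable.encode b)
      then some q.2 else none
  have hF : Primrec₂ F := by
    refine Primrec.option_bind (Primrec.decode.comp Primrec.snd) ?_
    refine Primrec.ite (c := fun z : (List α × ℕ) × ℕ × α => ∀ u ∈ z.1.1,
      c.evaln z.2.1 (Encodable.encode (z.2.2, u)) = some (Encodable.encode b)) ?_ ?_ ?_
    · exact hP.comp (Primrec.pair (Primrec.fst.comp Primrec.fst) Primrec.snd)
    · exact Primrec.option_some.comp (Primrec.snd.comp Primrec.snd)
    · exact Primrec.const none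
  have hdom : ∀ L, (Nat.rfindOpt (F L)).Dom := by
    intro L
    rw [Nat.rfindOpt_dom]
    obtain ⟨v, hv⟩ := h L
    -- Finitely many halting computations share a step bound.
    have hk : ∃ k, ∀ u ∈ L,
        Encodable.encode b ∈ c.evaln k (Encodable.encode (v, u)) := by
      clear hP hF F
      induction L with
      | nil => exact ⟨0, by simp⟩
      | cons u L ih =>
        obtain ⟨k, hk⟩ := ih fun w hw => hv w (List.mem_cons_of_mem _ hw)
        obtain ⟨l, hl⟩ := Nat.Partrec.Code.evaln_complete.1
          ((hcf _).2 (hv u List.mem_cons_self))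
        refine ⟨max k l, List.forall_mem_cons.2 ⟨?_, fun w hw => ?_⟩⟩
        · exact Nat.Partrec.Code.evaln_mono (le_max_right _ _) hl
        · exact Nat.Partrec.Code.evaln_mono (le_max_left _ _) (hk w hw)
    obtain ⟨k, hk⟩ := hk
    refine ⟨Encodable.encode (k, v), v, ?_⟩
    simp only [F, Encodable.encodek, Option.bind_some]
    exact if_pos hk
  refine ⟨fun L => (Nat.rfindOpt (F L)).get (hdom L), ?_, fun L u hu => ?_⟩
  · exact (Partrec.rfindOpt hF.to_comp).of_eq fun L => (Part.some_get (hdom L)).symm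
  · obtain ⟨N, hN⟩ := Nat.rfindOpt_spec (Part.get_mem (hdom L))
    obtain ⟨q, -, hq⟩ := Option.bind_eq_some_iff.1 (Option.mem_def.1 hN)
    split_ifs at hq with hcond
    beta_reduce
    rw [← Option.some.inj hq, ← hcf]
    exact Nat.Partrec.Code.evaln_sound (hcond u hu)

/-- Iterating a computable choice that depends on all earlier values gives a computable
sequence. -/
theorem exists_computable_seq {α : Type*} [Primcodable α] {R : α → α → Prop} {g : List α → α}
    (hg : Computable g) (hR : ∀ L, ∀ u ∈ L, R (g L) u) :
    ∃ s : ℕ → α, Computable s ∧ ∀ i j, i < j → R (s j) (s i) := by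
  let H : ℕ → List α := fun n => Nat.rec (motive := fun _ => List α) [] (fun _ L => g L :: L) n
  have hH : Computable H := by
    have : Computable fun p : ℕ × ℕ × List α => p.2.2 := Computable.snd.comp Computable.snd
    exact Computable.nat_rec (h := fun _ p => g p.2 :: p.2) Computable.id (Computable.const [])
      (Computable.list_cons.comp (hg.comp this) this).to₂
  have hmem : ∀ i j, i < j → g (H i) ∈ H j := by
    intro i j hij
    induction hij with
    | refl => exact List.mem_cons_self
    | step _ ih => exact List.mem_cons_of_mem _ ih
  exact ⟨fun n => g (H n), hg.comp hH, fun i j hij => hR _ _ (hmem i j hij)⟩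

end Computability

/-! ### From a partial solution to an enumeration -/

section WordProblem

variable {G : Type*} [Group G] {d : ℕ}

/-- In an infinite group, solving the word problem on a thick set of words yields a computable
sequence of words for pairwise distinct elements. -/
theorem SolvableWPOn.exists_computable_injective [Infinite G] {x : Fin d → G}
    {S : Set (FreeGroup (Fin d))} (hS : SolvableWPOn x S) (hx : Generates x) (hT : IsThick S) :
    ∃ s : ℕ → List (Fin d × Bool), Computable s ∧
      Function.Injective fun n => FreeGroup.lift x (FreeGroup.mk (s n)) := by
  obtain ⟨f, hf, hdom, hcorrect⟩ := hS
  have hp : Partrec fun p : List (Fin d × Bool) × List (Fin d × Bool) =>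
      f (FreeGroup.mk p.1 * (FreeGroup.mk p.2)⁻¹).toWord :=
    hf.comp primrec_toWord_mk_mul_mk_inv.to_comp
  obtain ⟨g, hg, hgf⟩ := exists_computable_forall_mem hp false fun L => by
    obtain ⟨v, hv⟩ := hT.exists_mul_inv_mem_and_lift_ne hx
      (FreeGroup.mk '' {u | u ∈ L}) (L.finite_toSet.image _)
    refine ⟨v.toWord, fun u hu => ?_⟩
    obtain ⟨hvS, hne⟩ := hv _ (Set.mem_image_of_mem _ hu)
    rw [FreeGroup.mk_toWord]
    have hb := Part.get_mem (hdom _ hvS)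
    have := mt (hcorrect _ _ hb).1 hne
    rwa [Bool.eq_false_iff.2 this] at hb
  obtain ⟨s, hs, hsep⟩ := exists_computable_seq (R := fun v u =>
    false ∈ f (FreeGroup.mk v * (FreeGroup.mk u)⁻¹).toWord) hg hgf
  refine ⟨s, hs, .of_lt_imp_ne fun i j hij heq => ?_⟩
  have h1 := (hcorrect _ _ (hsep i j hij)).2
  rw [map_mul, map_inv, mul_inv_eq_one] at h1
  exact Bool.false_ne_true (h1 heq.symm)

theorem AlgorithmicallyFinite.not_injective {m : ℕ} {a : Fin m → G}
    (hfin : AlgorithmicallyFinite a) (ha : Generates a) (x : Fin d → G)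
    {s : ℕ → List (Fin d × Bool)} (hs : Computable s) :
    ¬ Function.Injective fun n => FreeGroup.lift x (FreeGroup.mk (s n)) := by
  intro hinj
  -- Rewrite each generator `x i` as a word in `a`; this changes words but not the elements they
  -- represent.
  choose φ hφ using fun i => ha.lift_surjective (x i)
  have hcomp : (FreeGroup.lift a).comp (FreeGroup.lift φ) = FreeGroup.lift x :=
    FreeGroup.ext_hom _ _ fun i => by simp [hφ]
  have hval : ∀ w, FreeGroup.lift a (FreeGroup.lift φ w) = FreeGroup.lift x w :=
    DFunLike.congr_fun hcomp
  refine hfin ⟨fun n => FreeGroup.lift φ (FreeGroup.mk (s n)),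
    (primrec_toWord_lift_mk φ).to_comp.comp hs, Set.infinite_range_of_injective ?_, ?_⟩
  · intro i j hij
    apply hinj
    simpa only [hval] using congrArg (FreeGroup.lift a) hij
  · rintro _ ⟨i, rfl⟩ _ ⟨j, rfl⟩ hij
    simp only [hval] at hij
    rw [hinj hij]

theorem IsThick.not_solvableWPOn [Infinite G] {m : ℕ} {a : Fin m → G} (ha : Generates a)
    (hfin : AlgorithmicallyFinite a) {x : Fin d → G} (hx : Generates x)
    {S : Set (FreeGroup (Fin d))} (hT : IsThick S) : ¬ SolvableWPOn x S := fun hS =>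
  let ⟨_, hs, hinj⟩ := hS.exists_computable_injective hx hT
  hfin.not_injective ha x hs hinj

end WordProblem

end GenericWP

theorem mainTheorem4 {G : Type*} [Group G] [Infinite G]
    {m : ℕ} (a : Fin m → G) (ha : GenericWP.Generates a)
    (hfin : GenericWP.AlgorithmicallyFinite a) :
    ∀ (n : ℕ) (b : Fin n → G), GenericWP.Generates b →
      ¬ GenericWP.SolvableUBGenericWP b ∧ ¬ GenericWP.SolvableGenericWP b :=
  fun _ _ hb => ⟨fun ⟨_, hS, hWP⟩ => hS.isThick.not_solvableWPOn ha hfin hb hWP,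
    fun ⟨_, hS, hWP⟩ => hS.isThick.not_solvableWPOn ha hfin hb hWP⟩
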